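/- Let $W$ be a spherical or hyperbolic reflection group, in the following sense. Spherical case: $V$ is a finite-dimensional Euclidean space with inner product $B=(\cdot,\cdot)$, $X\subset V$ is its unit sphere, and $U=V$. Hyperbolic case: $V=\mathbb{R}^{n+1}$ with the Minkowski form $B(x,y)=[x,y]=-x_0y_0+x_1y_1+\dots+x_ny_n$, $X=\mathbb{H}^n=\{x\in V: [x,x]=-1,\ x_0>0\}$, and $U=\{x\in V: [x,x]<0,\ x_0>0\}$. In both cases $W$ is a group of linear transformations of $V$, generated by reflections $x\mapsto x-\frac{2B(x,e)}{B(e,e)}e$ with $B(e,e)>0$, that acts discretely (properly discontinuously) and cocompactly on $X$. Let $C$ be a chamber of $W$ in $V$, that is, the closure of a connected component of the complement in $U$ of the mirrors $\{x : B(x,e)=0\}$ of all reflections in $W$. Let $C^\circ$ be the interior of $C$, and let $C^*=\{y\in V: B(x,y)\ge 0 \text{ for all } x\in C\}$ be its dual cone. Then the sets $(1-w)C^\circ=\{x-wx : x\in C^\circ\}$, $w\in W$, are pairwise disjoint, and $$C^*\supseteq\bigsqcup_{w\in W}(1-w)C^\circ .$$ -/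

import Mathlib

namespace ReflTiling

/-- `g` is the reflection along a vector `e` of positive square, with respect to the bilinear
form `B`: `g x = x - 2 B(x, e) / B(e, e) • e`, with mirror the hyperplane `{x | B(x, e) = 0}`. -/
def IsReflectionAlong {V : Type*} [AddCommGroup V] [Module ℝ V]
    (B : LinearMap.BilinForm ℝ V) (e : V) (g : V ≃ₗ[ℝ] V) : Prop :=
  0 < B e e ∧ ∀ x, g x = x - (2 * B x e / B e e) • e

/-- A linear group `W` which acts on the model space `X` as a cocompact discrete group
generated by reflections. (Reflections along vectors of positive square map the model spaces
considered below to themselves.) -/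
structure IsCocompactReflectionGroup {V : Type*} [AddCommGroup V] [Module ℝ V]
    [TopologicalSpace V] (B : LinearMap.BilinForm ℝ V) (X : Set V)
    (W : Subgroup (V ≃ₗ[ℝ] V)) : Prop where
  /-- `W` is generated by the reflections which it contains -/
  generated : Subgroup.closure {g | g ∈ W ∧ ∃ e, IsReflectionAlong B e g} = W
  /-- `W` acts discretely (properly discontinuously) on `X` -/
  discrete : ∀ K ⊆ X, IsCompact K → {w | w ∈ W ∧ ((w '' K) ∩ K).Nonempty}.Finite
  /-- some compact part of `X` meets every orbit -/
  cocompact : ∃ K ⊆ X, IsCompact K ∧ X ⊆ ⋃ w ∈ W, w '' K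

/-- The union of the mirrors of all reflections in `W`. -/
def mirrors {V : Type*} [AddCommGroup V] [Module ℝ V]
    (B : LinearMap.BilinForm ℝ V) (W : Subgroup (V ≃ₗ[ℝ] V)) : Set V :=
  {x | ∃ g ∈ W, ∃ e, IsReflectionAlong B e g ∧ B x e = 0}

/-- `C` is a (closed) chamber of `W` in the open cone `U`: the closure of a connected component
of the complement in `U` of the mirrors of `W`. -/
def IsChamber {V : Type*} [AddCommGroup V] [Module ℝ V] [TopologicalSpace V]
    (B : LinearMap.BilinForm ℝ V) (U : Set V) (W : Subgroup (V ≃ₗ[ℝ] V)) (C : Set V) : Prop :=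
  ∃ x ∈ U \ mirrors B W, C = closure (connectedComponentIn (U \ mirrors B W) x)

/-- The set `(1 - w) C°`. -/
def tile {V : Type*} [AddCommGroup V] [Module ℝ V] [TopologicalSpace V]
    (C : Set V) (w : V ≃ₗ[ℝ] V) : Set V :=
  (fun x => x - w x) '' interior C

/-- The Minkowski form `[x, y] = -x₀y₀ + x₁y₁ + ⋯ + xₙyₙ`. -/
def minkowski (n : ℕ) : LinearMap.BilinForm ℝ (Fin (n + 1) → ℝ) :=
  LinearMap.mk₂ ℝ (fun x y => -(x 0 * y 0) + ∑ i : Fin n, x i.succ * y i.succ)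
    (by intro x y z; simp only [Pi.add_apply, add_mul, Finset.sum_add_distrib]; ring)
    (by intro c x y; simp only [Pi.smul_apply, smul_eq_mul, mul_add, Finset.mul_sum]
        congr 1
        · ring
        · exact Finset.sum_congr rfl fun i _ => by ring)
    (by intro x y z; simp only [Pi.add_apply, mul_add, Finset.sum_add_distrib]; ring)
    (by intro c x y; simp only [Pi.smul_apply, smul_eq_mul, mul_add, Finset.mul_sum]
        congr 1
        · ring
        · exact Finset.sum_congr rfl fun i _ => by ring)

/-- Hyperbolic space `ℍⁿ`: one sheet of the hyperboloid `[x, x] = -1`. -/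
def hyperboloid (n : ℕ) : Set (Fin (n + 1) → ℝ) :=
  {x | minkowski n x x = -1 ∧ 0 < x 0}

/-- The open cone `{x | [x, x] < 0, x₀ > 0}` over `ℍⁿ`. -/
def futureCone (n : ℕ) : Set (Fin (n + 1) → ℝ) :=
  {x | minkowski n x x < 0 ∧ 0 < x 0}

/-- Spherical reflection groups in a Euclidean space `V`, acting on the unit sphere of `V`. -/
def IsSphericalReflectionGroup {V : Type*} [NormedAddCommGroup V] [InnerProductSpace ℝ V]
    (W : Subgroup (V ≃ₗ[ℝ] V)) : Prop :=
  IsCocompactReflectionGroup (innerₗ V) (Metric.sphere (0 : V) 1) W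

/-- Hyperbolic reflection groups, acting on `ℍⁿ`. -/
def IsHyperbolicReflectionGroup {n : ℕ}
    (W : Subgroup ((Fin (n + 1) → ℝ) ≃ₗ[ℝ] (Fin (n + 1) → ℝ))) : Prop :=
  IsCocompactReflectionGroup (minkowski n) (hyperboloid n) W

end ReflTiling

/-! Everything rests on one inequality, `form_lt`: `B (w x) y < B x y` for `w ≠ 1` and `x`, `y`
strictly on the side of `c` of every mirror. It makes `B (x - w x) y` nonnegative, which is the
inclusion. If `x - w x = x' - w' x'`, taking squares of `x - x' = w x - w' x'` gives `B x x' = B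
(w'⁻¹ w x) x'`, which forces `w = w'`. The inequality is proved by induction on words in simple
reflections, with the exchange property removing letters that do not decrease the form. That simple
reflections generate `W` is a descent on the height `B e c` of unit roots `e`. The descent needs `B`
to be positive definite on the orthogonal complement of `c`, and only finitely many roots below each
height; the latter comes from discreteness. -/

namespace ReflTiling

/-! ### Roots, simple reflections and the exchange property. -/

section Abstract

variable {V : Type*} [AddCommGroup V] [Module ℝ V]

/-- The normalized roots of the reflections in `W`. -/
def IsUnitRoot (B : LinearMap.BilinForm ℝ V) (W : Subgroup (V ≃ₗ[ℝ] V)) (e : V) : Prop :=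
  B e e = 1 ∧ ∃ g ∈ W, IsReflectionAlong B e g

/-- The simple reflections of `W` with respect to the base point `c`: those reflections whose
root is the only unit root, positive on `c`, which they make non-positive on `c`. -/
def simpleReflections (B : LinearMap.BilinForm ℝ V) (W : Subgroup (V ≃ₗ[ℝ] V)) (c : V) :
    Set (V ≃ₗ[ℝ] V) :=
  {g | g ∈ W ∧ ∃ e, B e e = 1 ∧ IsReflectionAlong B e g ∧ 0 < B e c ∧
    ∀ f, IsUnitRoot B W f → 0 < B f c → f ≠ e → 0 < B (g f) c}

/-- The points on the same side as `c` of all mirrors of `W`. -/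
def sameSide (B : LinearMap.BilinForm ℝ V) (W : Subgroup (V ≃ₗ[ℝ] V)) (c : V) : Set V :=
  {y | ∀ e, IsUnitRoot B W e → 0 < B e c → 0 < B e y}

variable {B : LinearMap.BilinForm ℝ V} {W : Subgroup (V ≃ₗ[ℝ] V)} {c : V}

theorem IsReflectionAlong.apply_unit {e : V} {g : V ≃ₗ[ℝ] V} (h : IsReflectionAlong B e g)
    (he : B e e = 1) (x : V) : g x = x - (2 * B x e) • e := by
  rw [h.2, he, div_one]

theorem IsReflectionAlong.eq {e : V} {g g' : V ≃ₗ[ℝ] V} (h : IsReflectionAlong B e g)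
    (h' : IsReflectionAlong B e g') : g = g' := by
  ext x
  rw [h.2, h'.2]

theorem IsReflectionAlong.mul_self {e : V} {g : V ≃ₗ[ℝ] V} (h : IsReflectionAlong B e g) :
    g * g = 1 := by
  ext x
  have h0 := h.1.ne'
  simp only [LinearEquiv.mul_apply, h.2, map_sub, map_smul, LinearMap.sub_apply,
    LinearMap.smul_apply, smul_eq_mul, LinearEquiv.coe_one, id]
  rw [sub_sub, ← add_smul]
  have : 2 * B x e / B e e + 2 * (B x e - 2 * B x e / B e e * B e e) / B e e = 0 := by
    field_simp
    ring
  rw [this, zero_smul, sub_zero]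

theorem IsReflectionAlong.smul {e : V} {g : V ≃ₗ[ℝ] V} (h : IsReflectionAlong B e g) {a : ℝ}
    (ha : a ≠ 0) : IsReflectionAlong B (a • e) g := by
  have h0 := h.1.ne'
  refine ⟨?_, fun x => ?_⟩
  · have := h.1
    simp only [map_smul, LinearMap.smul_apply, smul_eq_mul]
    rw [← mul_assoc]
    exact mul_pos (mul_self_pos.2 ha) this
  · rw [h.2, smul_smul]
    simp only [map_smul, LinearMap.smul_apply, smul_eq_mul]
    congr 2
    field_simp

theorem IsReflectionAlong.exists_unit {e : V} {g : V ≃ₗ[ℝ] V} (h : IsReflectionAlong B e g) :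
    ∃ a : ℝ, 0 < a ∧ B (a • e) (a • e) = 1 ∧ IsReflectionAlong B (a • e) g := by
  have hs : 0 < √(B e e) := Real.sqrt_pos.2 h.1
  refine ⟨(√(B e e))⁻¹, inv_pos.2 hs, ?_, h.smul (inv_pos.2 hs).ne'⟩
  simp only [map_smul, LinearMap.smul_apply, smul_eq_mul]
  have := Real.mul_self_sqrt h.1.le
  field_simp
  linarith

theorem IsReflectionAlong.isometry (hB : ∀ x y, B x y = B y x) {e : V} {g : V ≃ₗ[ℝ] V}
    (h : IsReflectionAlong B e g) (x y : V) : B (g x) (g y) = B x y := by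
  have h0 := h.1.ne'
  simp only [h.2, map_sub, map_smul, LinearMap.sub_apply, LinearMap.smul_apply, smul_eq_mul]
  rw [hB e y]
  field_simp
  ring

/-- Any group generated by reflections preserves the form. -/
theorem isometry_of_generated (hB : ∀ x y, B x y = B y x)
    (hgen : Subgroup.closure {g | g ∈ W ∧ ∃ e, IsReflectionAlong B e g} = W)
    {w : V ≃ₗ[ℝ] V} (hw : w ∈ W) : ∀ x y, B (w x) (w y) = B x y := by
  rw [← hgen] at hw
  induction hw using Subgroup.closure_induction with
  | mem g hg => obtain ⟨-, e, he⟩ := hg; exact he.isometry hB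
  | one => intro x y; rfl
  | mul g g' _ _ h h' => intro x y; rw [LinearEquiv.mul_apply, LinearEquiv.mul_apply, h, h']
  | inv g _ h =>
    intro x y
    rw [← h (g⁻¹ x) (g⁻¹ y), ← LinearEquiv.mul_apply, ← LinearEquiv.mul_apply, mul_inv_cancel]
    rfl

theorem IsReflectionAlong.conj {e : V} {g w : V ≃ₗ[ℝ] V} (h : IsReflectionAlong B e g)
    (hw : ∀ x y, B (w x) (w y) = B x y) : IsReflectionAlong B (w e) (w * g * w⁻¹) := by
  refine ⟨by rw [hw]; exact h.1, fun x => ?_⟩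
  have hx : w (w⁻¹ x) = x := by rw [← LinearEquiv.mul_apply, mul_inv_cancel]; rfl
  rw [LinearEquiv.mul_apply, LinearEquiv.mul_apply, h.2, map_sub, map_smul, hx, hw]
  have : B (w⁻¹ x) e = B x (w e) := by rw [← hw, hx]
  rw [this]

theorem IsUnitRoot.map {e : V} (he : IsUnitRoot B W e) {w : V ≃ₗ[ℝ] V} (hw : w ∈ W)
    (hiso : ∀ x y, B (w x) (w y) = B x y) : IsUnitRoot B W (w e) := by
  obtain ⟨h1, g, hg, hge⟩ := he
  exact ⟨by rw [hiso, h1], _, W.mul_mem (W.mul_mem hw hg) (W.inv_mem hw), hge.conj hiso⟩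

theorem IsUnitRoot.neg {e : V} (he : IsUnitRoot B W e) : IsUnitRoot B W (-e) := by
  obtain ⟨h1, g, hg, hge⟩ := he
  refine ⟨by simp [h1], g, hg, ?_⟩
  simpa using hge.smul (a := -1) (by norm_num)

/-- A unit root of a non-simple reflection can be reflected to a unit root of smaller height,
along a unit root of smaller height. -/
theorem exists_lower_root (hB : ∀ x y, B x y = B y x)
    (hpos : ∀ v, B v c = 0 → v ≠ 0 → 0 < B v v)
    {e f : V} (he : B e e = 1) (hf : B f f = 1) (hec : 0 < B e c) (hfc : 0 < B f c)
    (hne : f ≠ e) (hneg : B (f - (2 * B f e) • e) c < 0) :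
    (B f c < B e c ∧ |B (e - (2 * B e f) • f) c| < B e c) ∨
    (B ((2 * B f e) • e - f) c < B e c ∧
      |B (e - (2 * B e ((2 * B f e) • e - f)) • ((2 * B f e) • e - f)) c| < B e c) := by
  -- This combination is orthogonal to `c`. Its positive square says that the heights of `f` and of
  -- `(2 * B f e) • e - f` have product less than the squared height of `e`.
  have hgram : 0 < B ((B f c) • e - (B e c) • f) ((B f c) • e - (B e c) • f) := by
    apply hpos
    · simp only [map_sub, map_smul, LinearMap.sub_apply, LinearMap.smul_apply, smul_eq_mul]
      ring
    · intro h0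
      have h1 : (B f c) • e = (B e c) • f := sub_eq_zero.1 h0
      have h2 : B ((B f c) • e) ((B f c) • e) = B ((B e c) • f) ((B e c) • f) := by rw [h1]
      simp only [map_smul, LinearMap.smul_apply, smul_eq_mul, he, hf, mul_one] at h2
      have h3 : B f c = B e c := by nlinarith
      rw [h3] at h1
      exact hne (smul_right_injective V hec.ne' h1).symm
  simp only [map_sub, map_smul, LinearMap.sub_apply, LinearMap.smul_apply, smul_eq_mul, he, hf,
    hB e f] at hgram hneg ⊢
  set b := B f e
  set p := B e c
  set q := B f c
  have hpq : q * (2 * b * p - q) < p * p := by nlinarith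
  have hb : 0 < b := by
    by_contra hb
    nlinarith [mul_nonneg (neg_nonneg.2 (not_lt.1 hb)) hec.le]
  -- The two heights have mean `b * p`. The smaller one, `m`, satisfies `m * (b * p) < p * p`, so `0
  -- < b * m < p`, and reflecting `e` along that root gives height `p - 2 * b * m`.
  rcases le_or_gt q (2 * b * p - q) with h | h
  · left
    have hq : q < p := by nlinarith
    refine ⟨hq, abs_lt.2 ⟨?_, ?_⟩⟩
    · have : b * q * p < p * p := by nlinarith
      have := lt_of_mul_lt_mul_right this hec.le
      linarith
    · nlinarith [mul_pos hb hfc]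
  · right
    have hq : 2 * b * p - q < p := by nlinarith
    have hb2 : b * (2 * b * p - q) * p < p * p := by nlinarith
    have hb3 := lt_of_mul_lt_mul_right hb2 hec.le
    refine ⟨by linarith, abs_lt.2 ⟨?_, ?_⟩⟩
    · linarith
    · have : 0 < b * (2 * b * p - q) := mul_pos hb (by linarith)
      linarith

/-- Every reflection of `W` is a product of simple ones. -/
theorem reflection_mem_closure_simple (hB : ∀ x y, B x y = B y x)
    (hiso : ∀ w ∈ W, ∀ x y, B (w x) (w y) = B x y)
    (hpos : ∀ v, B v c = 0 → v ≠ 0 → 0 < B v v)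
    (hc : ∀ e, IsUnitRoot B W e → B e c ≠ 0)
    (hfin : ∀ t : ℝ, {e | IsUnitRoot B W e ∧ 0 < B e c ∧ B e c ≤ t}.Finite)
    {e : V} {g : V ≃ₗ[ℝ] V} (hg : g ∈ W) (hge : IsReflectionAlong B e g) :
    g ∈ Subgroup.closure (simpleReflections B W c) := by
  suffices h : ∀ e, IsUnitRoot B W e → 0 < B e c → ∀ g ∈ W, IsReflectionAlong B e g →
      g ∈ Subgroup.closure (simpleReflections B W c) by
    obtain ⟨a, ha, h1, h2⟩ := hge.exists_unit
    have hr : IsUnitRoot B W (a • e) := ⟨h1, g, hg, h2⟩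
    rcases (hc _ hr).lt_or_gt with h0 | h0
    · refine h (-(a • e)) hr.neg (by simpa using h0) g hg ?_
      simpa using h2.smul (a := -1) (by norm_num)
    · exact h _ hr h0 g hg h2
  clear hge hg g e
  by_contra! hcon
  obtain ⟨e₀, hr₀, hp₀, g₀, hg₀, hge₀, hn₀⟩ := hcon
  obtain ⟨e, ⟨⟨hr, hp, g, hg, hge, hn⟩, hle⟩, hmin⟩ := Set.exists_min_image
    {e | (IsUnitRoot B W e ∧ 0 < B e c ∧ ∃ g ∈ W, IsReflectionAlong B e g ∧
      g ∉ Subgroup.closure (simpleReflections B W c)) ∧ B e c ≤ B e₀ c} (fun e => B e c)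
    ((hfin (B e₀ c)).subset fun e he => ⟨he.1.1, he.1.2.1, he.2⟩)
    ⟨e₀, ⟨hr₀, hp₀, g₀, hg₀, hge₀, hn₀⟩, le_rfl⟩
  have low : ∀ e', IsUnitRoot B W e' → 0 < B e' c → B e' c < B e c → ∀ g ∈ W,
      IsReflectionAlong B e' g → g ∈ Subgroup.closure (simpleReflections B W c) := by
    intro e' hr' hp' hlt g' hg' hge'
    by_contra hn'
    exact (hmin e' ⟨⟨hr', hp', g', hg', hge', hn'⟩, (hlt.le.trans hle)⟩).not_gt hlt
  -- Conjugating `g` by the reflection in `d` gives a reflection with lower root; minimality puts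
  -- both in the closure, hence `g` too.
  have key : ∀ d, IsUnitRoot B W d → 0 < B d c → B d c < B e c →
      |B (e - (2 * B e d) • d) c| < B e c → False := by
    intro d hd hdp hdlt habs
    obtain ⟨k, hk, hkd⟩ := hd.2
    have hkS := low d hd hdp hdlt k hk hkd
    rw [← hkd.apply_unit hd.1] at habs
    have hkr := hr.map hk (hiso k hk)
    have hconj := hge.conj (hiso k hk)
    have hmem : k * g * k⁻¹ ∈ W := W.mul_mem (W.mul_mem hk hg) (W.inv_mem hk)
    have hcS : k * g * k⁻¹ ∈ Subgroup.closure (simpleReflections B W c) := by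
      rcases (hc _ hkr).lt_or_gt with h0 | h0
      · refine low (-(k e)) hkr.neg (by simpa using h0) ?_ _ hmem ?_
        · rw [abs_of_neg h0] at habs
          simpa using habs
        · simpa using hconj.smul (a := -1) (by norm_num)
      · exact low _ hkr h0 (by rwa [abs_of_pos h0] at habs) _ hmem hconj
    apply hn
    have : g = k⁻¹ * (k * g * k⁻¹) * k := by group
    rw [this]
    exact Subgroup.mul_mem _ (Subgroup.mul_mem _ (Subgroup.inv_mem _ hkS) hcS) hkS
  have hns : g ∉ simpleReflections B W c := fun h => hn (Subgroup.subset_closure h)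
  have : ∃ f, IsUnitRoot B W f ∧ 0 < B f c ∧ f ≠ e ∧ B (g f) c < 0 := by
    by_contra! hcon
    refine hns ⟨hg, e, hr.1, hge, hp, fun f hf hfp hfe => ?_⟩
    exact lt_of_le_of_ne (hcon f hf hfp hfe) (hc _ (hf.map hg (hiso g hg))).symm
  obtain ⟨f, hf, hfp, hfe, hgf⟩ := this
  have hfr : IsUnitRoot B W ((2 * B f e) • e - f) := by
    have h1 := (hf.map hg (hiso g hg)).neg
    rwa [hge.apply_unit hr.1, neg_sub] at h1
  rw [hge.apply_unit hr.1] at hgf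
  rcases exists_lower_root hB hpos hr.1 hf.1 hp hfp hfe hgf with ⟨h1, h2⟩ | ⟨h1, h2⟩
  · exact key f hf hfp h1 h2
  · refine key _ hfr ?_ h1 h2
    rw [← neg_sub, map_neg, LinearMap.neg_apply]
    linarith

/-- The exchange property for words in the simple reflections. -/
theorem exchange (hiso : ∀ w ∈ W, ∀ x y, B (w x) (w y) = B x y)
    (hc : ∀ e, IsUnitRoot B W e → B e c ≠ 0)
    {e : V} {g : V ≃ₗ[ℝ] V} (he : IsUnitRoot B W e) (hge : IsReflectionAlong B e g)
    (hp : 0 < B e c) (l : List (V ≃ₗ[ℝ] V)) (hl : ∀ s ∈ l, s ∈ simpleReflections B W c)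
    (hneg : B (l.prod e) c < 0) :
    ∃ l' : List (V ≃ₗ[ℝ] V), (∀ s ∈ l', s ∈ simpleReflections B W c) ∧
      l'.length < l.length ∧ l'.prod = l.prod * g := by
  induction l with
  | nil => exact absurd hneg (by simpa using hp.le)
  | cons s l ih =>
    have hs := hl s (by simp)
    have hl' : ∀ s ∈ l, s ∈ simpleReflections B W c := fun t ht => hl t (by simp [ht])
    have hlW : l.prod ∈ W := W.list_prod_mem fun t ht => (hl' t ht).1
    have hr := he.map hlW (hiso _ hlW)
    rcases (hc _ hr).lt_or_gt with h0 | h0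
    · obtain ⟨l', h1, h2, h3⟩ := ih hl' h0
      refine ⟨s :: l', ?_, by simpa using h2, by simp [h3, mul_assoc]⟩
      intro t ht
      rcases List.mem_cons.1 ht with rfl | ht
      · exact hs
      · exact h1 t ht
    · obtain ⟨hsW, a, ha, hsa, hap, hsimple⟩ := hs
      -- A simple reflection makes only its own positive root negative. Hence `s` is the conjugate
      -- of `g` by `l.prod`, and `s * l.prod * g = l.prod`.
      have hea : l.prod e = a := by
        by_contra hne
        have := hsimple _ hr h0 hne
        rw [List.prod_cons, LinearEquiv.mul_apply] at hneg
        exact this.not_gt hneg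
      have hconj := hge.conj (hiso _ hlW)
      rw [hea] at hconj
      have hsg := hsa.eq hconj
      refine ⟨l, hl', by simp, ?_⟩
      have h2 := hsa.mul_self
      nth_rewrite 2 [hsg] at h2
      rw [List.prod_cons]
      calc l.prod = 1 * l.prod := (one_mul _).symm
        _ = s * l.prod * g := by rw [← h2]; group

/-- For a last letter `s` with root `a`, `B (l' s x) y = B (l' x) y - 2 * B a x * B (l' a) y`. If
`l' a` is positive the form drops; otherwise exchange gives a shorter word for the same element. -/
theorem form_lt_of_word (hiso : ∀ w ∈ W, ∀ x y, B (w x) (w y) = B x y)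
    (hB : ∀ x y, B x y = B y x) (hc : ∀ e, IsUnitRoot B W e → B e c ≠ 0) {x y : V}
    (hx : x ∈ sameSide B W c) (hy : y ∈ sameSide B W c) (n : ℕ) :
    ∀ l : List (V ≃ₗ[ℝ] V), l.length = n → (∀ s ∈ l, s ∈ simpleReflections B W c) →
      l.prod = 1 ∨ B (l.prod x) y < B x y := by
  induction n using Nat.strong_induction_on with
  | _ n ih =>
    intro l hln hl
    rcases List.eq_nil_or_concat l with rfl | ⟨l', s, rfl⟩
    · simp
    rw [List.concat_eq_append] at hl hln ⊢
    have hl' : ∀ t ∈ l', t ∈ simpleReflections B W c := fun t ht => hl t (by simp [ht])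
    have hlen : l'.length < n := by rw [← hln]; simp
    obtain ⟨hsW, a, ha, hsa, hap, -⟩ := hl s (by simp)
    have har : IsUnitRoot B W a := ⟨ha, s, hsW, hsa⟩
    have hlW : l'.prod ∈ W := W.list_prod_mem fun t ht => (hl' t ht).1
    have hr := har.map hlW (hiso _ hlW)
    have hprod : (l' ++ [s]).prod = l'.prod * s := by simp
    rw [hprod]
    rcases (hc _ hr).lt_or_gt with h0 | h0
    · obtain ⟨m, h1, h2, h3⟩ := exchange hiso hc har hsa hap l' hl' h0
      rw [← h3]
      exact ih m.length (h2.trans hlen) m rfl h1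
    · right
      have h1 : B (l'.prod x) y ≤ B x y := by
        rcases ih _ hlen l' rfl hl' with h | h
        · rw [h]; rfl
        · exact h.le
      have h2 := hy _ hr h0
      have h3 := hx _ har hap
      rw [LinearEquiv.mul_apply, hsa.apply_unit ha]
      simp only [map_sub, map_smul, LinearMap.sub_apply, LinearMap.smul_apply, smul_eq_mul]
      rw [hB x a]
      nlinarith [mul_pos h2 h3]

/-- A nontrivial element of a reflection group strictly decreases the form between points of one
open chamber. -/
theorem form_lt (hB : ∀ x y, B x y = B y x)
    (hgen : Subgroup.closure {g | g ∈ W ∧ ∃ e, IsReflectionAlong B e g} = W)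
    (hpos : ∀ v, B v c = 0 → v ≠ 0 → 0 < B v v)
    (hc : ∀ e, IsUnitRoot B W e → B e c ≠ 0)
    (hfin : ∀ t : ℝ, {e | IsUnitRoot B W e ∧ 0 < B e c ∧ B e c ≤ t}.Finite)
    {x y : V} (hx : x ∈ sameSide B W c) (hy : y ∈ sameSide B W c)
    {w : V ≃ₗ[ℝ] V} (hw : w ∈ W) (hw1 : w ≠ 1) : B (w x) y < B x y := by
  have hiso : ∀ w ∈ W, ∀ x y, B (w x) (w y) = B x y := fun w hw =>
    isometry_of_generated hB hgen hw
  have hwS : w ∈ Subgroup.closure (simpleReflections B W c) := by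
    rw [← hgen] at hw
    refine (Subgroup.closure_le _).2 ?_ hw
    rintro g ⟨hg, e, hge⟩
    exact reflection_mem_closure_simple hB hiso hpos hc hfin hg hge
  rw [← Subgroup.mem_toSubmonoid, Subgroup.closure_toSubmonoid] at hwS
  obtain ⟨l, hl, rfl⟩ := Submonoid.exists_list_of_mem_closure hwS
  refine (form_lt_of_word hiso hB hc hx hy _ l rfl fun s hs => ?_).resolve_left hw1
  rcases hl s hs with h | h
  · exact h
  · obtain ⟨-, e, -, he, -⟩ := id h
    have := inv_eq_of_mul_eq_one_left he.mul_self
    rw [inv_inv] at this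
    rw [this]
    exact h

/-- A reflection determines its unit root up to sign, and positivity on `c` fixes the sign. -/
theorem finite_unitRoots {t : ℝ}
    (h : {g | g ∈ W ∧ ∃ e, B e e = 1 ∧ IsReflectionAlong B e g ∧ 0 < B e c ∧ B e c ≤ t}.Finite) :
    {e | IsUnitRoot B W e ∧ 0 < B e c ∧ B e c ≤ t}.Finite := by
  refine (h.biUnion (t := fun g => {e | B e e = 1 ∧ IsReflectionAlong B e g ∧ 0 < B e c})
    fun g _ => Set.Subsingleton.finite ?_).subset ?_
  · rintro e ⟨he, hge, hep⟩ f ⟨hf, hgf, hfp⟩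
    have h1 := hge.apply_unit he f
    rw [hgf.apply_unit hf, hf] at h1
    have h2 : f = (B f e) • e := by
      have h3 : (2 : ℝ) • f = (2 : ℝ) • ((B f e) • e) := by
        rw [smul_smul, ← sub_right_inj (a := f), ← h1, mul_one]
      exact smul_right_injective V (two_ne_zero' ℝ) h3
    have h4 : B f c = B f e * B e c := by
      conv_lhs => rw [h2]
      simp
    have h5 : B f e * B f e = 1 := by
      rw [← hf]
      conv_rhs => rw [h2]
      simp [he]
    have h6 : 0 < B f e := pos_of_mul_pos_left (h4 ▸ hfp) hep.le
    have h7 : B f e = 1 := by nlinarith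
    rw [h7, one_smul] at h2
    exact h2.symm
  · rintro e ⟨⟨he, g, hg, hge⟩, hep, hle⟩
    exact Set.mem_biUnion (x := g) ⟨hg, e, he, hge, hep, hle⟩ ⟨he, hge, hep⟩

end Abstract

/-! ### From chambers to sign conditions, and the general theorem. -/

section Topological

variable {V : Type*} [NormedAddCommGroup V] [NormedSpace ℝ V] [FiniteDimensional ℝ V]
  {B : LinearMap.BilinForm ℝ V} {W : Subgroup (V ≃ₗ[ℝ] V)} {c : V} {U : Set V}

theorem component_subset_sameSide (hB : ∀ x y, B x y = B y x) (hcU : c ∈ U \ mirrors B W) :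
    connectedComponentIn (U \ mirrors B W) c ⊆ sameSide B W c := by
  rintro y hy e ⟨he, g, hg, hge⟩ hec
  have hcont : Continuous (B e) := LinearMap.continuous_of_finiteDimensional _
  have himg := (isPreconnected_connectedComponentIn (x := c)
    (F := U \ mirrors B W)).image (B e) hcont.continuousOn
  by_contra hle
  have h0 : (0 : ℝ) ∈ B e '' connectedComponentIn (U \ mirrors B W) c :=
    himg.ordConnected.out (Set.mem_image_of_mem _ hy)
      (Set.mem_image_of_mem _ (mem_connectedComponentIn hcU)) ⟨not_lt.1 hle, hec.le⟩
  obtain ⟨z, hz, hz0⟩ := h0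
  exact (connectedComponentIn_subset _ _ hz).2 ⟨g, hg, e, hge, by rw [hB, hz0]⟩

/-- On the closure only weak inequalities survive. At an interior point they become strict, since a
small step along `-e` stays in the closure and lowers `B e`. -/
theorem interior_subset_sameSide (hB : ∀ x y, B x y = B y x) (hcU : c ∈ U \ mirrors B W) :
    interior (closure (connectedComponentIn (U \ mirrors B W) c)) ⊆ sameSide B W c := by
  intro y hy e he hec
  have hcont : Continuous (B e) := LinearMap.continuous_of_finiteDimensional _
  have hsub : closure (connectedComponentIn (U \ mirrors B W) c) ⊆ {z | 0 ≤ B e z} :=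
    closure_minimal (fun z hz => (component_subset_sameSide hB hcU hz e he hec).le)
      (isClosed_le continuous_const hcont)
  have hpath : Filter.Tendsto (fun t : ℝ => y - t • e) (nhdsWithin 0 (Set.Ioi 0)) (nhds y) := by
    have : Continuous fun t : ℝ => y - t • e := by fun_prop
    have h := this.tendsto 0
    simp only [zero_smul, sub_zero] at h
    exact h.mono_left nhdsWithin_le_nhds
  obtain ⟨t, ht, ht0⟩ := ((hpath.eventually (mem_interior_iff_mem_nhds.1 hy)).and
    self_mem_nhdsWithin).exists
  have h1 : 0 ≤ B e (y - t • e) := hsub ht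
  simp only [map_sub, map_smul, smul_eq_mul, he.1, mul_one] at h1
  have : (0 : ℝ) < t := ht0
  linarith

theorem tiles_disjoint_and_subset_dual (hB : ∀ x y, B x y = B y x)
    (hgen : Subgroup.closure {g | g ∈ W ∧ ∃ e, IsReflectionAlong B e g} = W)
    (hcU : c ∈ U \ mirrors B W)
    (hpos : ∀ v, B v c = 0 → v ≠ 0 → 0 < B v v)
    (hfin : ∀ t : ℝ, {g | g ∈ W ∧ ∃ e, B e e = 1 ∧ IsReflectionAlong B e g ∧ 0 < B e c ∧
      B e c ≤ t}.Finite)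
    {C : Set V} (hC : C = closure (connectedComponentIn (U \ mirrors B W) c)) :
    (W : Set (V ≃ₗ[ℝ] V)).PairwiseDisjoint (tile C) ∧
      (⋃ w ∈ W, tile C w) ⊆ (PointedCone.dual B C : Set V) := by
  subst hC
  have hc : ∀ e, IsUnitRoot B W e → B e c ≠ 0 := by
    rintro e ⟨-, g, hg, hge⟩ h0
    exact hcU.2 ⟨g, hg, e, hge, by rw [hB, h0]⟩
  have hlt : ∀ x ∈ sameSide B W c, ∀ y ∈ sameSide B W c, ∀ w ∈ W, w ≠ 1 → B (w x) y < B x y :=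
    fun x hx y hy w hw hw1 =>
      form_lt hB hgen hpos hc (fun t => finite_unitRoots (hfin t)) hx hy hw hw1
  have hint := interior_subset_sameSide hB hcU
  constructor
  · intro w hw w' hw' hne
    refine Set.disjoint_left.2 ?_
    rintro _ ⟨x, hx, rfl⟩ ⟨x', hx', heq⟩
    have hiso := isometry_of_generated hB hgen hw
    have hiso' := isometry_of_generated hB hgen hw'
    have h1 : x - x' = w x - w' x' := by
      have : x' - w' x' = x - w x := heq
      rw [sub_eq_sub_iff_add_eq_add] at this ⊢
      rw [← this, add_comm]
    have h2 : B (x - x') (x - x') = B (w x - w' x') (w x - w' x') := by rw [h1]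
    simp only [map_sub, LinearMap.sub_apply, hiso, hiso', hB x' x, hB (w' x') (w x)] at h2
    have h3 : B ((w'⁻¹ * w) x) x' = B (w x) (w' x') := by
      rw [← hiso', LinearEquiv.mul_apply, ← LinearEquiv.mul_apply w', mul_inv_cancel]
      rfl
    have h4 := hlt x (hint hx) x' (hint hx') (w'⁻¹ * w) (W.mul_mem (W.inv_mem hw') hw)
      (fun h => hne (inv_mul_eq_one.1 h).symm)
    linarith
  · intro z hz
    simp only [Set.mem_iUnion] at hz
    obtain ⟨w, hw, x, hx, rfl⟩ := hz
    have hcont : Continuous (B (x - w x)) := LinearMap.continuous_of_finiteDimensional _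
    have hsub : closure (connectedComponentIn (U \ mirrors B W) c) ⊆ {y | 0 ≤ B (x - w x) y} := by
      refine closure_minimal (fun y hy => ?_) (isClosed_le continuous_const hcont)
      change 0 ≤ B (x - w x) y
      simp only [map_sub, LinearMap.sub_apply, sub_nonneg]
      by_cases hw1 : w = 1
      · rw [hw1]; rfl
      · exact (hlt x (hint hx) y (component_subset_sameSide hB hcU hy) w hw hw1).le
    intro y hy
    rw [hB]
    exact hsub hy

end Topological

/-! ### Minkowski geometry: the two inputs in the hyperbolic case. -/

section Minkowski

variable {n : ℕ}

theorem minkowski_apply (x y : Fin (n + 1) → ℝ) :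
    minkowski n x y = -(x 0 * y 0) + ∑ i : Fin n, x i.succ * y i.succ := rfl

theorem minkowski_comm (x y : Fin (n + 1) → ℝ) : minkowski n x y = minkowski n y x := by
  simp only [minkowski_apply, mul_comm]

/-- Cauchy–Schwarz for the spatial parts. -/
theorem minkowski_sq_le (x y : Fin (n + 1) → ℝ) :
    (minkowski n x y + x 0 * y 0) ^ 2 ≤
      (minkowski n x x + x 0 ^ 2) * (minkowski n y y + y 0 ^ 2) := by
  have h := Finset.sum_mul_sq_le_sq_mul_sq Finset.univ (fun i : Fin n => x i.succ)
    (fun i : Fin n => y i.succ)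
  simp only [minkowski_apply, ← sq]
  refine (le_of_eq ?_).trans (h.trans (le_of_eq ?_)) <;> ring

theorem minkowski_add_sq_nonneg (x : Fin (n + 1) → ℝ) : 0 ≤ minkowski n x x + x 0 ^ 2 := by
  have h : 0 ≤ ∑ i : Fin n, x i.succ * x i.succ :=
    Finset.sum_nonneg fun i _ => mul_self_nonneg _
  rw [minkowski_apply]
  linarith [sq (x 0)]

theorem minkowski_pos_of_orthogonal {c v : Fin (n + 1) → ℝ} (hc : c ∈ futureCone n)
    (hv : minkowski n v c = 0) (hv0 : v ≠ 0) : 0 < minkowski n v v := by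
  obtain ⟨hc1, hc0⟩ := hc
  have h1 := minkowski_sq_le v c
  have h2 := minkowski_add_sq_nonneg v
  rw [hv, zero_add] at h1
  rcases h2.eq_or_lt with h | h
  · exfalso
    rw [← h, zero_mul] at h1
    have hz : v 0 = 0 := by
      have := pow_eq_zero_iff two_ne_zero |>.1 (le_antisymm h1 (sq_nonneg _))
      exact (mul_eq_zero.1 this).resolve_right hc0.ne'
    have hs : ∑ i : Fin n, v i.succ * v i.succ = 0 := by
      rw [minkowski_apply] at h
      nlinarith
    rw [Finset.sum_eq_zero_iff_of_nonneg fun i _ => mul_self_nonneg _] at hs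
    apply hv0
    ext i
    refine Fin.cases hz (fun j => ?_) i
    exact mul_self_eq_zero.1 (hs j (Finset.mem_univ j))
  · have h3 : (v 0 * c 0) ^ 2 < (minkowski n v v + v 0 ^ 2) * c 0 ^ 2 := by nlinarith
    rw [mul_pow] at h3
    have := lt_of_mul_lt_mul_right h3 (sq_nonneg _)
    linarith

/-- A vector of non-positive square with bounded product with a point of the future cone has a
bounded time coordinate. -/
theorem futureCone_time_bound {c : Fin (n + 1) → ℝ} (hc : c ∈ futureCone n) :
    ∃ δ : ℝ, 0 < δ ∧ ∀ z, minkowski n z z ≤ 0 → |z 0| * δ ≤ |minkowski n z c| ∧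
      (minkowski n z c < 0 → 0 ≤ z 0) := by
  obtain ⟨hc1, hc0⟩ := hc
  set r := √(minkowski n c c + c 0 ^ 2) with hr
  have hr2 : r ^ 2 = minkowski n c c + c 0 ^ 2 := Real.sq_sqrt (minkowski_add_sq_nonneg c)
  have hr0 : 0 ≤ r := Real.sqrt_nonneg _
  have hrc : r < c 0 := by nlinarith
  -- Here `r` is the length of the spatial part of `c`, less than `c 0` because `c` is timelike.
  refine ⟨c 0 - r, by linarith, fun z hz => ?_⟩
  have h1 := minkowski_sq_le z c
  have h2 : (minkowski n z c + z 0 * c 0) ^ 2 ≤ (|z 0| * r) ^ 2 := by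
    rw [mul_pow, hr2, sq_abs]
    have := minkowski_add_sq_nonneg c
    nlinarith
  have h3 := abs_le.1 (abs_le_of_sq_le_sq h2 (by positivity))
  rcases le_total 0 (z 0) with h | h
  · rw [abs_of_nonneg h] at h3 ⊢
    refine ⟨?_, fun _ => h⟩
    have := neg_abs_le (minkowski n z c)
    nlinarith
  · rw [abs_of_nonpos h] at h3 ⊢
    refine ⟨?_, fun hneg => ?_⟩
    · have := le_abs_self (minkowski n z c)
      nlinarith
    · nlinarith

theorem continuous_minkowski_self : Continuous fun x : Fin (n + 1) → ℝ => minkowski n x x := by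
  simp only [minkowski_apply]
  fun_prop

/-- The product with `c` bounds the time coordinate, which in turn bounds the spatial ones. -/
theorem isCompact_hyperboloid_cap {c : Fin (n + 1) → ℝ} (hc : c ∈ futureCone n) (T : ℝ) :
    IsCompact {z | z ∈ hyperboloid n ∧ -T ≤ minkowski n z c} := by
  obtain ⟨δ, hδ, hb⟩ := futureCone_time_bound hc
  have hcont : Continuous fun z : Fin (n + 1) → ℝ => minkowski n z c := by
    simp only [minkowski_apply]
    fun_prop
  have hset : {z | z ∈ hyperboloid n ∧ -T ≤ minkowski n z c} =
      {z | minkowski n z z = -1} ∩ ({z | 0 ≤ z 0} ∩ {z | -T ≤ minkowski n z c}) := by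
    ext z
    refine ⟨fun h => ⟨h.1.1, h.1.2.le, h.2⟩, fun h => ⟨⟨h.1, lt_of_le_of_ne h.2.1 ?_⟩, h.2.2⟩⟩
    intro h0
    have h1 : minkowski n z z = -1 := h.1
    have := minkowski_add_sq_nonneg z
    rw [h1, ← h0] at this
    norm_num at this
  refine Metric.isCompact_of_isClosed_isBounded ?_ ?_
  · rw [hset]
    exact (isClosed_eq continuous_minkowski_self continuous_const).inter
      ((isClosed_le continuous_const (continuous_apply 0)).inter
        (isClosed_le continuous_const hcont))
  · refine (Metric.isBounded_closedBall (x := 0) (r := |T| / δ)).subset ?_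
    rintro z ⟨⟨hz1, hz0⟩, hzT⟩
    have hneg : minkowski n z c < 0 := by
      by_contra hcon
      obtain ⟨hc1, hc0⟩ := hc
      have h1 := minkowski_sq_le z c
      rw [hz1] at h1
      have h2 : 0 < z 0 * c 0 := mul_pos hz0 hc0
      have h3 := minkowski_add_sq_nonneg c
      have h4 : (z 0 * c 0) ^ 2 ≤ (minkowski n z c + z 0 * c 0) ^ 2 :=
        pow_le_pow_left₀ h2.le (by linarith) 2
      nlinarith [mul_pos (pow_pos hz0 2) (neg_pos.2 hc1)]
    have hz0T : z 0 ≤ |T| / δ := by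
      rw [le_div_iff₀ hδ]
      have h1 := (hb z (by rw [hz1]; norm_num)).1
      rw [abs_of_pos hz0, abs_of_neg hneg] at h1
      linarith [le_abs_self T]
    rw [mem_closedBall_zero_iff, pi_norm_le_iff_of_nonneg (by positivity)]
    intro i
    refine le_trans ?_ hz0T
    rw [Real.norm_eq_abs]
    refine Fin.cases (abs_of_pos hz0).le (fun j => ?_) i
    refine abs_le_of_sq_le_sq ?_ hz0.le
    have h1 : z j.succ * z j.succ ≤ ∑ i : Fin n, z i.succ * z i.succ :=
      Finset.single_le_sum (f := fun i : Fin n => z i.succ * z i.succ)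
        (fun i _ => mul_self_nonneg _) (Finset.mem_univ j)
    rw [minkowski_apply] at hz1
    nlinarith

/-- A reflection whose root has height at most `t` moves the normalized `c` by a bounded amount, so
point and image lie in one compact cap, to which discreteness applies. -/
theorem IsHyperbolicReflectionGroup.finite_reflections
    {W : Subgroup ((Fin (n + 1) → ℝ) ≃ₗ[ℝ] (Fin (n + 1) → ℝ))}
    (hW : IsHyperbolicReflectionGroup W) {c : Fin (n + 1) → ℝ} (hc : c ∈ futureCone n) (t : ℝ) :
    {g | g ∈ W ∧ ∃ e, minkowski n e e = 1 ∧ IsReflectionAlong (minkowski n) e g ∧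
      0 < minkowski n e c ∧ minkowski n e c ≤ t}.Finite := by
  set k := √(-minkowski n c c) with hk
  have hkpos : 0 < k := Real.sqrt_pos.2 (by linarith [hc.1])
  have hk2 : k * k = -minkowski n c c := Real.mul_self_sqrt (by linarith [hc.1])
  have hcc : minkowski n c c = -(k * k) := by linarith
  have hcX : k⁻¹ • c ∈ hyperboloid n := by
    refine ⟨?_, ?_⟩
    · simp only [map_smul, LinearMap.smul_apply, smul_eq_mul, hcc]
      field_simp
    · exact mul_pos (inv_pos.2 hkpos) hc.2
  refine (hW.discrete {z | z ∈ hyperboloid n ∧ -(k + k⁻¹ * (2 * t ^ 2)) ≤ minkowski n z c}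
    (fun z hz => hz.1) (isCompact_hyperboloid_cap hc _)).subset ?_
  rintro g ⟨hg, e, he, hge, hp, hle⟩
  have hval : minkowski n (g (k⁻¹ • c)) c = -(k + k⁻¹ * (2 * minkowski n e c ^ 2)) := by
    rw [map_smul, hge.apply_unit he]
    simp only [map_sub, map_smul, LinearMap.sub_apply, LinearMap.smul_apply, smul_eq_mul, hcc,
      minkowski_comm c e]
    field_simp
    ring
  have hsq : minkowski n e c ^ 2 ≤ t ^ 2 := pow_le_pow_left₀ hp.le hle 2
  have hinv : 0 < k⁻¹ := inv_pos.2 hkpos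
  refine ⟨hg, g (k⁻¹ • c), ⟨_, ⟨hcX, ?_⟩, rfl⟩, ⟨?_, ?_⟩, ?_⟩
  · simp only [map_smul, LinearMap.smul_apply, smul_eq_mul, hcc]
    have h1 : k⁻¹ * -(k * k) = -k := by field_simp
    rw [h1]
    have : 0 ≤ k⁻¹ * (2 * t ^ 2) := by positivity
    linarith
  · rw [hge.isometry minkowski_comm]
    exact hcX.1
  · have h1 : minkowski n (g (k⁻¹ • c)) (g (k⁻¹ • c)) = -1 := by
      rw [hge.isometry minkowski_comm]
      exact hcX.1
    obtain ⟨δ, -, hb⟩ := futureCone_time_bound hc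
    have h2 : 0 ≤ (g (k⁻¹ • c)) 0 := by
      refine (hb _ (by rw [h1]; norm_num)).2 ?_
      rw [hval]
      have : 0 ≤ k⁻¹ * (2 * minkowski n e c ^ 2) := by positivity
      linarith
    refine lt_of_le_of_ne h2 fun h0 => ?_
    have := minkowski_add_sq_nonneg (g (k⁻¹ • c))
    rw [h1, ← h0] at this
    norm_num at this
  · rw [hval]
    have := mul_le_mul_of_nonneg_left (mul_le_mul_of_nonneg_left hsq zero_le_two) hinv.le
    linarith

end Minkowski

/-- The sphere itself is compact, and `e` and `g e = -e` both lie on it. -/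
theorem IsSphericalReflectionGroup.finite_reflections {V : Type*} [NormedAddCommGroup V]
    [InnerProductSpace ℝ V] [FiniteDimensional ℝ V] {W : Subgroup (V ≃ₗ[ℝ] V)}
    (hW : IsSphericalReflectionGroup W) :
    {g | g ∈ W ∧ ∃ e, innerₗ V e e = 1 ∧ IsReflectionAlong (innerₗ V) e g}.Finite := by
  refine (hW.discrete _ subset_rfl (isCompact_sphere (0 : V) 1)).subset ?_
  rintro g ⟨hg, e, he, hge⟩
  have hne : ‖e‖ = 1 := by
    rw [innerₗ_apply_apply, real_inner_self_eq_norm_sq] at he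
    nlinarith [norm_nonneg e]
  have hgee : g e = -e := by
    rw [hge.apply_unit he, he, mul_one, two_smul]
    abel
  exact ⟨hg, g e, ⟨e, by simpa using hne, rfl⟩, by simpa [hgee] using hne⟩

end ReflTiling

theorem lemma3 :
    (∀ (V : Type*) [NormedAddCommGroup V] [InnerProductSpace ℝ V] [FiniteDimensional ℝ V]
      (W : Subgroup (V ≃ₗ[ℝ] V)) (C : Set V),
      ReflTiling.IsSphericalReflectionGroup W →
      ReflTiling.IsChamber (innerₗ V) Set.univ W C →
        (W : Set (V ≃ₗ[ℝ] V)).PairwiseDisjoint (ReflTiling.tile C) ∧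
        (⋃ w ∈ W, ReflTiling.tile C w) ⊆ (PointedCone.dual (innerₗ V) C : Set V)) ∧
    (∀ (n : ℕ) (W : Subgroup ((Fin (n + 1) → ℝ) ≃ₗ[ℝ] (Fin (n + 1) → ℝ)))
      (C : Set (Fin (n + 1) → ℝ)),
      ReflTiling.IsHyperbolicReflectionGroup W →
      ReflTiling.IsChamber (ReflTiling.minkowski n) (ReflTiling.futureCone n) W C →
        (W : Set ((Fin (n + 1) → ℝ) ≃ₗ[ℝ] (Fin (n + 1) → ℝ))).PairwiseDisjoint
          (ReflTiling.tile C) ∧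
        (⋃ w ∈ W, ReflTiling.tile C w) ⊆
          (PointedCone.dual (ReflTiling.minkowski n) C : Set (Fin (n + 1) → ℝ))) := by
  constructor
  · rintro V _ _ _ W C hW ⟨c, hc, hC⟩
    refine ReflTiling.tiles_disjoint_and_subset_dual (fun x y => ?_) hW.generated hc ?_
      (fun t => hW.finite_reflections.subset ?_) hC
    · exact real_inner_comm y x
    · intro v _ hv
      exact real_inner_self_pos.2 hv
    · rintro g ⟨hg, e, he, hge, -⟩
      exact ⟨hg, e, he, hge⟩
  · rintro n W C hW ⟨c, hc, hC⟩
    exact ReflTiling.tiles_disjoint_and_subset_dual ReflTiling.minkowski_comm hW.generated hc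
      (fun v => ReflTiling.minkowski_pos_of_orthogonal hc.1)
      (fun t => hW.finite_reflections hc.1 t) hC
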